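/- **Theorem 4.3.** Let $\mathbb F=\mathbb F_q$ be a finite field, let $n=q-1$, let $\alpha\in\mathbb F$ be an element of multiplicative order $n$, and let $k$ be an integer with $1\le k\le n/2$. Put $A=\mathbb F[x]/\langle x^n-1\rangle$ and let $\mathfrak v:A\to\mathbb F^n$ be the inverse of the isomorphism $(v_0,\dots,v_{n-1})\mapsto\sum_{i=0}^{n-1}v_ix^i$. Let $\sigma$ be the $\mathbb F$-algebra automorphism of $A$ with $\sigma(x)=\alpha^kx$. For $0\le i\le n-1$ let $\varepsilon_i\in A$ be the primitive idempotent determined by $\varepsilon_i \bmod (x-\alpha^j)=\delta_{ij}$ for $0\le j\le n-1$, and put $c=\varepsilon_{n-k}+\dots+\varepsilon_{n-1}$. Let $1\le m\le\lfloor n/k\rfloor-1$ and let $$G=\sum_{\nu=0}^m z^\nu G_\nu\in\mathbb F[z]^{k\times n},$$ where $G_\nu\in\mathbb F^{k\times n}$ is the matrix with rows $\mathfrak v(\sigma^\nu(c)),\mathfrak v(\sigma^\nu(xc)),\dots,\mathfrak v(\sigma^\nu(x^{k-1}c))$. Let $\mathcal C=\{uG\mid u\in\mathbb F[z]^k\}\subseteq\mathbb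 F[z]^n$ be the resulting Reed–Solomon convolutional code. The weight of $v=\sum_j z^jv_j\in\mathbb F[z]^n$ (with $v_j\in\mathbb F^n$) is $\mathrm{wt}(v)=\sum_j\mathrm{wt}(v_j)$, where $\mathrm{wt}(v_j)$ is the Hamming weight; the free distance is $\mathrm{dist}(\mathcal C)=\min\{\mathrm{wt}(v)\mid v\in\mathcal C,\ v\ne0\}$. For $j\ge m+1$ the $j$th extended row distance $\hat d^r_j$ of $\mathcal C$ is the minimum of $\mathrm{wt}(uG)$ over all $u=\sum_i z^iu_i\in\mathbb F[z]^k$ (with $u_i\in\mathbb F^k$) such that $u_0\ne0$, $\deg u=j-m-1$, and no $m$ consecutive coefficients among $u_0,\dots,u_{\deg u}$ are all zero. Then 1. $\mathrm{dist}(\mathcal C)=(m+1)(n-k+1)$; 2. $\hat d^r_j\ge(m+1)(n-k+1)+(j-1-m)\bigl(n-k(m+1)+1\bigr)$ for all $j\ge m+1$. -/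

import Mathlib

open Polynomial

noncomputable section

namespace RSConv

variable {F : Type*} [Field F]

/-! ### Weight, degree and distance for polynomial vectors -/

/-- The coefficient vector `v_j ∈ F^ι` of `z^j` in `v = ∑ z^j v_j ∈ F[z]^ι`. -/
def coeffVec {ι : Type*} (v : ι → F[X]) (j : ℕ) : ι → F := fun l => (v l).coeff j

/-- The degree of a polynomial vector: the maximum of the degrees of its components
(`⊥` for the zero vector). -/
def vecDegree {ι : Type*} [Fintype ι] (v : ι → F[X]) : WithBot ℕ :=
  Finset.univ.sup fun l => (v l).degree

open Classical in
/-- The weight of `v = ∑_{j ≤ N} z^j v_j`: the sum of the Hamming weights of the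
coefficient vectors `v_j`. -/
def polyWeight {ι : Type*} [Fintype ι] (v : ι → F[X]) : ℕ :=
  ∑ j ∈ Finset.range (Finset.univ.sup (fun l => (v l).natDegree) + 1), hammingNorm (coeffVec v j)

/-- The submodule `im G = {uG | u ∈ F[z]^k}` of `F[z]^n`. -/
def code {k n : ℕ} (G : Matrix (Fin k) (Fin n) F[X]) : Submodule F[X] (Fin n → F[X]) :=
  LinearMap.range G.vecMulLinear

/-- The free distance `min {wt v | v ∈ C, v ≠ 0}`. -/
def freeDist {n : ℕ} (C : Submodule F[X] (Fin n → F[X])) : ℕ :=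
  sInf {w | ∃ v ∈ C, v ≠ 0 ∧ polyWeight v = w}

/-- The messages `u` with `u_0 ≠ 0`, `deg u = j - m - 1`, and such that no `m` consecutive
coefficients among `u_0, …, u_{deg u}` all vanish. -/
def IsAtomicMessage {k : ℕ} (m j : ℕ) (u : Fin k → F[X]) : Prop :=
  coeffVec u 0 ≠ 0 ∧ vecDegree u + m + 1 = j ∧
    ∀ i : ℕ, (i : WithBot ℕ) + m ≤ vecDegree u + 1 → ∃ l < m, coeffVec u (i + l) ≠ 0

/-- The `j`th extended row distance (`j ≥ m + 1`) of `im G`, where `G` is a minimal generator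
matrix all of whose row degrees are equal to `m`. -/
def extRowDist {k n : ℕ} (G : Matrix (Fin k) (Fin n) F[X]) (m j : ℕ) : ℕ :=
  sInf {w | ∃ u : Fin k → F[X], IsAtomicMessage m j u ∧ polyWeight (Matrix.vecMul u G) = w}

/-! ### The algebra `A = F[x]/(x^n - 1)` -/

variable (F) in
/-- `A = F[x]/(x^n - 1)`. -/
abbrev CycAlg (n : ℕ) : Type _ := AdjoinRoot (X ^ n - 1 : F[X])

variable (F) in
/-- The residue class of `x` in `A`. -/
def gen (n : ℕ) : CycAlg F n := AdjoinRoot.root (X ^ n - 1 : F[X])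

theorem monic_X_pow_sub_one (n : ℕ) [NeZero n] : (X ^ n - 1 : F[X]).Monic := by
  simpa using monic_X_pow_sub_C (1 : F) (NeZero.ne n)

/-- The coordinate map `A → F^n`, inverse to `(v_0, …, v_{n-1}) ↦ ∑ v_i x^i`: the coefficients of
the remainder modulo `x^n - 1`. -/
def coords {n : ℕ} [NeZero n] (a : CycAlg F n) : Fin n → F :=
  fun i => (AdjoinRoot.modByMonicHom (monic_X_pow_sub_one n) a).coeff i

theorem gen_pow (n : ℕ) : gen F n ^ n = 1 := by
  have h : AdjoinRoot.mk (X ^ n - 1 : F[X]) (X ^ n - 1) = 0 := AdjoinRoot.mk_self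
  rw [map_sub, map_pow, AdjoinRoot.mk_X, map_one, sub_eq_zero] at h
  exact h

/-- The endomorphism of the `F`-algebra `A` with `x ↦ a x`, where `a^n = 1`. -/
def scaleHom {n : ℕ} (a : F) (ha : a ^ n = 1) : CycAlg F n →ₐ[F] CycAlg F n :=
  AdjoinRoot.liftAlgHom (X ^ n - 1 : F[X]) (Algebra.ofId F (CycAlg F n)) (a • gen F n) (by
    simp [_root_.smul_pow, ha, gen_pow])

theorem scaleHom_gen {n : ℕ} (a : F) (ha : a ^ n = 1) :
    scaleHom a ha (gen F n) = a • gen F n := by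
  simp only [scaleHom]
  exact AdjoinRoot.liftAlgHom_root _ _ _ _

theorem scaleHom_comp {n : ℕ} (a b : F) (ha : a ^ n = 1) (hb : b ^ n = 1) (hab : a * b = 1) :
    (scaleHom a ha).comp (scaleHom b hb) = AlgHom.id F (CycAlg F n) := by
  apply AdjoinRoot.algHom_ext
  change scaleHom a ha (scaleHom b hb (gen F n)) = gen F n
  rw [scaleHom_gen, map_smul, scaleHom_gen, smul_smul, mul_comm, hab, one_smul]

/-- The automorphism of the `F`-algebra `A` with `x ↦ a x`, where `a^n = 1` and `n > 0`. -/
def scaleAut {n : ℕ} [NeZero n] (a : F) (ha : a ^ n = 1) : CycAlg F n ≃ₐ[F] CycAlg F n :=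
  have h0 : a ≠ 0 := by
    rintro rfl
    simp [NeZero.ne n] at ha
  AlgEquiv.ofAlgHom (scaleHom a ha) (scaleHom a⁻¹ (by rw [inv_pow, ha, inv_one]))
    (scaleHom_comp _ _ _ _ (mul_inv_cancel₀ h0)) (scaleHom_comp _ _ _ _ (inv_mul_cancel₀ h0))

theorem scaleAut_gen {n : ℕ} [NeZero n] (a : F) (ha : a ^ n = 1) :
    scaleAut a ha (gen F n) = a • gen F n := scaleHom_gen a ha

/-! ### The generator matrix of a doubly-cyclic code -/

/-- The matrix `G_ν` with rows `𝔳(σ^ν(x^i c))`, `0 ≤ i < k`. -/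
def coeffMatrix {n : ℕ} [NeZero n] (σ : CycAlg F n ≃ₐ[F] CycAlg F n) (c : CycAlg F n) (k ν : ℕ) :
    Matrix (Fin k) (Fin n) F :=
  Matrix.of fun i => coords ((σ ^ ν) (gen F n ^ (i : ℕ) * c))

/-- The matrix `G = ∑_{ν = 0}^m z^ν G_ν`. -/
def genMatrix {n : ℕ} [NeZero n] (σ : CycAlg F n ≃ₐ[F] CycAlg F n) (c : CycAlg F n) (k m : ℕ) :
    Matrix (Fin k) (Fin n) F[X] :=
  ∑ ν ∈ Finset.range (m + 1), (X ^ ν : F[X]) • (coeffMatrix σ c k ν).map C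

/-! ### The Reed-Solomon data -/

/-- For `α` of order `n` and `i < n`: the primitive idempotent `ε_i` of `A`, i.e. the element with
`ε_i mod (x - α^j) = δ_ij` for all `j < n`, given as a scalar multiple of
`∏_{j ≠ i} (x - α^j)`. -/
def idem (n : ℕ) (α : F) (i : ℕ) : CycAlg F n :=
  AdjoinRoot.mk _ (Lagrange.basis (Finset.range n) (fun j => α ^ j) i)

/-- The defining property of the representing polynomial of `ε_i`. -/
theorem idem_mod {n : ℕ} {α : F} (hα : orderOf α = n) {i j : ℕ} (hi : i < n) (hj : j < n) :
    Lagrange.basis (Finset.range n) (fun j => α ^ j) i %ₘ (X - C (α ^ j)) =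
      if i = j then 1 else 0 := by
  have hinj : Set.InjOn (fun j => α ^ j) (Finset.range n : Set ℕ) := by
    intro a ha b hb h
    simp only [Finset.coe_range, Set.mem_Iio] at ha hb
    subst hα
    exact pow_injOn_Iio_orderOf ha hb h
  rw [modByMonic_X_sub_C_eq_C_eval]
  split_ifs with h
  · subst h
    have := Lagrange.eval_basis_self hinj (Finset.mem_range.2 hi)
    rw [this, C_1]
  · have := Lagrange.eval_basis_of_ne (v := fun j => α ^ j) h (Finset.mem_range.2 hj)
    rw [this, C_0]

/-- The idempotent `c = ε_{n-k} + ⋯ + ε_{n-1}`. -/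
def rsIdem (n : ℕ) (α : F) (k : ℕ) : CycAlg F n := ∑ i ∈ Finset.Ico (n - k) n, idem n α i

theorem pow_pow_of_order {n : ℕ} {α : F} (hα : orderOf α = n) (k : ℕ) : (α ^ k) ^ n = 1 := by
  rw [← hα, pow_right_comm, pow_orderOf_eq_one, one_pow]

/-- The automorphism `σ` of `A` with `σ(x) = α^k x`. -/
def rsAut {n : ℕ} [NeZero n] {α : F} (hα : orderOf α = n) (k : ℕ) : CycAlg F n ≃ₐ[F] CycAlg F n :=
  scaleAut (α ^ k) (pow_pow_of_order hα k)

/-- The generator matrix of the Reed-Solomon convolutional code. -/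
def rsMatrix {n : ℕ} [NeZero n] {α : F} (hα : orderOf α = n) (k m : ℕ) :
    Matrix (Fin k) (Fin n) F[X] :=
  genMatrix (rsAut hα k) (rsIdem n α k) k m

end RSConv

end

/-!
By the inverse Fourier transform, the word of `f c` consists of the values at `1, α, …, α^{n-1}` of
a polynomial `X M_f` with `deg M_f < k`, and `σ^ν` multiplies its `l`th entry by `(α^l)^{kν}`. The
`k` rows of `G_ν` thus fill the exponents `kν + 1, …, kν + k`, so that a nontrivial combination of
`d` consecutive blocks `G_ν` is, up to a monomial factor, the value vector of a nonzero polynomial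
of degree less than `kd`. Counting roots, it has weight at least `n + 1 - kd`.

The coefficient of `z^t` in `uG` combines those `G_ν` for which `u_{t-ν}` can be nonzero. If `u`
starts at time `a` and its first gap of `m` zeros follows time `b`, then each `t ∈ [a, b + m]`
contributes, and every `G_ν` occurs for exactly `b - a + 1` of these `t`, so summation yields
`wt(uG) ≥ (b - a + 1 + m)(n + 1) - k (b - a + 1)(m + 1)`. For the `j`th extended row distance,
`a = 0` and `b = j - m - 1`. For the free distance, the bound is weakest if `b = a`, where it is
attained by a constant message whose word under `G_0` meets the Singleton bound.
-/

namespace RSConv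

open scoped Matrix

section ReedSolomon

variable {F ι : Type*} [Field F] [DecidableEq F] [Fintype ι]

theorem card_le_hammingNorm_eval_add_natDegree {x : ι → F}
    (hx : Function.Injective x) {c : ι → F} (hc : ∀ i, c i ≠ 0) {p : F[X]} (hp : p ≠ 0) :
    Fintype.card ι ≤ hammingNorm (fun i => c i * p.eval (x i)) + p.natDegree := by
  have hroots : (({i | p.eval (x i) = 0} : Finset ι).image x).card ≤ p.natDegree :=
    card_le_degree_of_subset_roots fun y hy => by
      obtain ⟨i, hi, rfl⟩ := Finset.mem_image.1 hy
      exact (mem_roots hp).2 (Finset.mem_filter.1 hi).2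
  rw [Finset.card_image_of_injective _ hx] at hroots
  have hsupp : hammingNorm (fun i => c i * p.eval (x i)) =
      ({i | ¬p.eval (x i) = 0} : Finset ι).card := by
    simp only [hammingNorm, ne_eq, mul_eq_zero, hc, false_or]
  rw [hsupp, ← Finset.card_univ,
    ← Finset.card_filter_add_card_filter_not (s := Finset.univ) fun i => p.eval (x i) = 0]
  omega

/-- The Singleton bound. -/
theorem exists_ne_zero_hammingNorm_add_finrank_le {V : Type*} [AddCommGroup V] [Module F V]
    [Module.Finite F V] [Nontrivial V] (f : V →ₗ[F] ι → F)
    (hV : Module.finrank F V ≤ Fintype.card ι) :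
    ∃ v ≠ 0, hammingNorm (f v) + Module.finrank F V ≤ Fintype.card ι + 1 := by
  classical
  have hpos : 0 < Module.finrank F V := Module.finrank_pos
  obtain ⟨S, -, hS⟩ := Finset.exists_subset_card_eq
    (show Module.finrank F V - 1 ≤ (Finset.univ : Finset ι).card by
      rw [Finset.card_univ]; omega)
  obtain ⟨v, hv, hv0⟩ := (Submodule.ne_bot_iff _).1 <|
    LinearMap.ker_ne_bot_of_finrank_lt (f := LinearMap.funLeft F F ((↑) : S → ι) ∘ₗ f)
      (by rw [Module.finrank_fintype_fun_eq_card, Fintype.card_coe]; omega)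
  have hzero (i : ι) (hi : i ∈ S) : f v i = 0 := congrFun (LinearMap.mem_ker.1 hv) ⟨i, hi⟩
  have hsupp : hammingNorm (f v) ≤ Sᶜ.card := Finset.card_le_card fun i hi =>
    Finset.mem_compl.2 fun hiS => (Finset.mem_filter.1 hi).2 (hzero i hiS)
  rw [Finset.card_compl] at hsupp
  exact ⟨v, hv0, by omega⟩

end ReedSolomon

section Blocks

variable {R : Type*} [Semiring R] {k d : ℕ} {p : ℕ → R[X]}

theorem degree_sum_mul_X_pow_lt (hp : ∀ j, (p j).degree < k) :
    (∑ j ∈ Finset.range d, p j * X ^ (k * j)).degree < ↑(k * d) := by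
  rw [degree_lt_iff_coeff_zero]
  intro i hi
  rw [finsetSum_coeff]
  refine Finset.sum_eq_zero fun j hj => ?_
  have hjd : k * (j + 1) ≤ k * d := Nat.mul_le_mul_left k (Finset.mem_range.1 hj)
  rw [mul_add_one] at hjd
  rw [coeff_mul_X_pow', if_pos (by omega)]
  exact (degree_lt_iff_coeff_zero _ _).1 (hp j) _ (by omega)

theorem coeff_sum_mul_X_pow (hp : ∀ j, (p j).degree < k) {j r : ℕ} (hj : j < d) (hr : r < k) :
    (∑ j ∈ Finset.range d, p j * X ^ (k * j)).coeff (k * j + r) = (p j).coeff r := by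
  rw [finsetSum_coeff, Finset.sum_eq_single_of_mem j (Finset.mem_range.2 hj), add_comm,
    coeff_mul_X_pow]
  intro i _ hij
  rw [coeff_mul_X_pow']
  split_ifs with h
  · have hlt : i < j := by
      refine hij.lt_of_le (Nat.lt_succ_iff.1 (Nat.lt_of_mul_lt_mul_left (a := k) ?_))
      rw [Nat.succ_eq_add_one, mul_add_one]
      omega
    have hle : k * (i + 1) ≤ k * j := Nat.mul_le_mul_left k hlt
    rw [mul_add_one] at hle
    exact (degree_lt_iff_coeff_zero _ _).1 (hp i) _ (by omega)
  · rfl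

theorem sum_mul_X_pow_ne_zero (hp : ∀ j, (p j).degree < k) (h : ∃ j < d, p j ≠ 0) :
    ∑ j ∈ Finset.range d, p j * X ^ (k * j) ≠ 0 := by
  obtain ⟨j, hj, hpj⟩ := h
  refine fun h0 => hpj (ext fun r => ?_)
  rcases lt_or_ge r k with hr | hr
  · rw [← coeff_sum_mul_X_pow hp hj hr, h0]
    simp only [coeff_zero]
  · exact (degree_lt_iff_coeff_zero _ _).1 (hp j) r hr

end Blocks

section FourierTransform

variable {F : Type*} [Field F] {n : ℕ} {α : F}

theorem pow_injOn_range (hα : orderOf α = n) : Set.InjOn (α ^ ·) (Finset.range n : Set ℕ) := by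
  rw [Finset.coe_range, ← hα]
  exact pow_injOn_Iio_orderOf

theorem natCast_ne_zero_of_orderOf_eq [NeZero n] (hα : orderOf α = n) : (n : F) ≠ 0 :=
  (IsPrimitiveRoot.iff_orderOf.2 hα).neZero'.out

theorem sum_pow_mul_pow_reflect (hα : orderOf α = n) {i l : ℕ} (hi : i < n) (hl : l < n) :
    ∑ r ∈ Finset.range n, (α ^ (n - 1 - r)) ^ i * (α ^ l) ^ (r + 1) =
      if i = l then (n : F) else 0 := by
  have hgeom : ∑ r ∈ Finset.range n, (α ^ (n - 1 - r)) ^ i * (α ^ l) ^ (r + 1) =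
      (∑ r ∈ Finset.range n, (α ^ l) ^ r * (α ^ i) ^ (n - 1 - r)) * α ^ l := by
    rw [Finset.sum_mul]
    refine Finset.sum_congr rfl fun r _ => ?_
    rw [pow_right_comm α _ i, pow_succ]
    ring
  rw [hgeom]
  split_ifs with h
  · subst h
    rw [geom_sum₂_self, mul_assoc, ← pow_succ, Nat.sub_add_cancel (by omega),
      pow_pow_of_order hα, mul_one]
  · have hne : α ^ l - α ^ i ≠ 0 := sub_ne_zero.2 fun heq =>
      h (pow_injOn_range hα (by simpa using hl) (by simpa using hi) heq).symm
    have hzero := geom_sum₂_mul (α ^ l) (α ^ i) n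
    rw [pow_pow_of_order hα, pow_pow_of_order hα, sub_self] at hzero
    rw [(mul_eq_zero.1 hzero).resolve_right hne, zero_mul]

theorem natCast_mul_coords_mk [NeZero n] (hα : orderOf α = n) (f : F[X]) (l : Fin n) :
    (n : F) * coords (AdjoinRoot.mk _ f) l =
      ∑ r ∈ Finset.range n, f.eval (α ^ (n - 1 - r)) * (α ^ (l : ℕ)) ^ (r + 1) := by
  set g := f %ₘ (X ^ n - 1)
  have hdeg : g.natDegree < n := by
    have hdegree := degree_modByMonic_lt f (monic_X_pow_sub_one (F := F) n)
    rw [← C_1, degree_X_pow_sub_C (NeZero.pos n)] at hdegree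
    exact (WithBot.unbotD_lt_iff fun _ => NeZero.pos n).2 hdegree
  have heval (j : ℕ) : f.eval (α ^ j) = ∑ i ∈ Finset.range n, g.coeff i * (α ^ j) ^ i := by
    rw [← eval_eq_sum_range' hdeg]
    exact (eval₂_modByMonic_eq_self_of_root (by simp [pow_pow_of_order hα])).symm
  calc (n : F) * coords (AdjoinRoot.mk _ f) l
      = ∑ i ∈ Finset.range n, g.coeff i * if i = l then (n : F) else 0 := by
        rw [coords, AdjoinRoot.modByMonicHom_mk]
        simp [mul_comm, g]
    _ = ∑ r ∈ Finset.range n, ∑ i ∈ Finset.range n,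
          g.coeff i * ((α ^ (n - 1 - r)) ^ i * (α ^ (l : ℕ)) ^ (r + 1)) := by
        rw [Finset.sum_comm]
        refine Finset.sum_congr rfl fun i hi => ?_
        rw [← Finset.mul_sum, sum_pow_mul_pow_reflect hα (Finset.mem_range.1 hi) l.2]
    _ = _ := by simp only [heval, Finset.sum_mul, mul_assoc]

end FourierTransform

section CyclicAlgebra

variable {F : Type*} [Field F] {n k : ℕ} [NeZero n]

variable (F n) in
/-- The power basis `1, x, …, x^{n-1}` of `A = F[x]/(x^n - 1)`; its coordinate map is `coords`. -/
noncomputable def powBasis : Module.Basis (Fin n) F (CycAlg F n) :=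
  (AdjoinRoot.powerBasis' (monic_X_pow_sub_one n)).basis.reindex
    (finCongr (natDegree_X_pow_sub_C (n := n) (r := (1 : F))))

theorem powBasis_apply (i : Fin n) : powBasis F n i = gen F n ^ (i : ℕ) := by
  rw [powBasis, Module.Basis.reindex_apply, PowerBasis.basis_eq_pow]
  rfl

theorem equivFun_powBasis (a : CycAlg F n) : (powBasis F n).equivFun a = coords a := by
  ext i
  rw [Module.Basis.equivFun_apply, powBasis, Module.Basis.repr_reindex_apply]
  rfl

theorem coords_scaleAut (a : F) (ha : a ^ n = 1) (b : CycAlg F n) (i : Fin n) :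
    coords (scaleAut a ha b) i = a ^ (i : ℕ) * coords b i := by
  refine congrFun (g := fun i : Fin n => a ^ (i : ℕ) * coords b i) ?_ i
  rw [← equivFun_powBasis, ← LinearEquiv.eq_symm_apply, Module.Basis.equivFun_symm_apply]
  conv_lhs => rw [← (powBasis F n).sum_equivFun b]
  simp only [map_sum, map_smul, map_pow, powBasis_apply, equivFun_powBasis, scaleAut_gen,
    _root_.smul_pow, smul_smul, mul_comm]

theorem coords_scaleAut_pow (a : F) (ha : a ^ n = 1) (ν : ℕ) (b : CycAlg F n) (i : Fin n) :
    coords ((scaleAut a ha ^ ν) b) i = (a ^ (i : ℕ)) ^ ν * coords b i := by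
  induction ν with
  | zero => simp only [pow_zero, AlgEquiv.one_apply, one_mul]
  | succ ν ih => rw [pow_succ', AlgEquiv.mul_apply, coords_scaleAut, ih, pow_succ', mul_assoc]

theorem vecMul_coeffMatrix [DecidableEq F] (σ : CycAlg F n ≃ₐ[F] CycAlg F n) (c : CycAlg F n)
    (ν : ℕ) (w : Fin k → F) :
    w ᵥ* coeffMatrix σ c k ν = coords ((σ ^ ν) (AdjoinRoot.mk _ (ofFn k w) * c)) := by
  have hmsg : AdjoinRoot.mk (X ^ n - 1) (ofFn k w) = ∑ i, w i • gen F n ^ (i : ℕ) := by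
    simp [ofFn_eq_sum_monomial, ← C_mul_X_pow_eq_monomial, gen, Algebra.smul_def]
  simp only [Matrix.vecMul_eq_sum, hmsg, Finset.sum_mul, smul_mul_assoc, map_sum, map_smul,
    ← equivFun_powBasis]
  simp only [equivFun_powBasis]
  rfl

end CyclicAlgebra

section MattsonSolomon

variable {F : Type*} [Field F] {n k : ℕ} {α : F}

theorem eval_sum_lagrangeBasis (hα : orderOf α = n) {j : ℕ} (hj : j < n) :
    (∑ i ∈ Finset.Ico (n - k) n, Lagrange.basis (Finset.range n) (α ^ ·) i).eval (α ^ j) =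
      if n - k ≤ j then 1 else 0 := by
  rw [eval_finsetSum, Finset.sum_congr rfl fun i hi => ?_, Finset.sum_ite_eq' _ j fun _ => (1 : F)]
  · simp only [Finset.mem_Ico, hj, and_true]
  · have hmod := idem_mod hα (Finset.mem_Ico.1 hi).2 hj
    rw [modByMonic_X_sub_C_eq_C_eval] at hmod
    exact C_injective (by rw [hmod, apply_ite C, C_1, C_0])

/-- The polynomial `n⁻¹ ∑_{r < k} f(α^{n-1-r}) X^r`, i.e. the Mattson–Solomon polynomial of `f c`
for the idempotent `c = ε_{n-k} + ⋯ + ε_{n-1}`, divided by `X`: the word `coords (f c)` consists of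
the values of `X * mattsonSolomon n α k f` at `1, α, …, α^{n-1}`. -/
noncomputable def mattsonSolomon (n : ℕ) (α : F) (k : ℕ) (f : F[X]) : F[X] :=
  ∑ r ∈ Finset.range k, C ((n : F)⁻¹ * f.eval (α ^ (n - 1 - r))) * X ^ r

theorem coeff_mattsonSolomon (f : F[X]) (r : ℕ) :
    (mattsonSolomon n α k f).coeff r =
      if r < k then (n : F)⁻¹ * f.eval (α ^ (n - 1 - r)) else 0 := by
  simp only [mattsonSolomon, finsetSum_coeff, coeff_C_mul_X_pow, Finset.sum_ite_eq,
    Finset.mem_range]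

theorem degree_mattsonSolomon_lt (f : F[X]) : (mattsonSolomon n α k f).degree < k :=
  (degree_lt_iff_coeff_zero _ _).2 fun r hr => by
    rw [coeff_mattsonSolomon, if_neg hr.not_gt]

variable [NeZero n]

theorem mattsonSolomon_ne_zero (hα : orderOf α = n) (hk : k ≤ n) {f : F[X]} (hf : f ≠ 0)
    (hdeg : f.degree < k) : mattsonSolomon n α k f ≠ 0 := by
  refine fun h0 => hf (eq_zero_of_degree_lt_of_eval_index_eq_zero (s := Finset.range k)
    (v := fun r => α ^ (n - 1 - r)) (fun r hr r' hr' heq => ?_)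
    (by rwa [Finset.card_range]) fun r hr => ?_)
  · rw [Finset.coe_range, Set.mem_Iio] at hr hr'
    have := pow_injOn_range hα (Finset.mem_coe.2 (Finset.mem_range.2 (by omega)))
      (Finset.mem_coe.2 (Finset.mem_range.2 (by omega))) heq
    omega
  · have hcoeff := coeff_mattsonSolomon (n := n) (α := α) (k := k) f r
    rw [h0, coeff_zero, if_pos (Finset.mem_range.1 hr)] at hcoeff
    exact (mul_eq_zero.1 hcoeff.symm).resolve_left
      (inv_ne_zero (natCast_ne_zero_of_orderOf_eq hα))

theorem coords_mk_mul_rsIdem (hα : orderOf α = n) (hk : k ≤ n) (f : F[X]) (l : Fin n) :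
    coords (AdjoinRoot.mk _ f * rsIdem n α k) l =
      α ^ (l : ℕ) * (mattsonSolomon n α k f).eval (α ^ (l : ℕ)) := by
  set c : F[X] := ∑ i ∈ Finset.Ico (n - k) n, Lagrange.basis (Finset.range n) (α ^ ·) i
  have hc : rsIdem n α k = AdjoinRoot.mk _ c := by simp only [rsIdem, idem, c, map_sum]
  have heval (r : ℕ) (hr : r < n) : c.eval (α ^ (n - 1 - r)) = if r < k then 1 else 0 := by
    rw [eval_sum_lagrangeBasis hα (by omega)]
    exact if_congr (by omega) rfl rfl
  have hn := natCast_ne_zero_of_orderOf_eq hα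
  refine mul_left_cancel₀ hn ?_
  rw [hc, ← map_mul, natCast_mul_coords_mk hα, mattsonSolomon, eval_finsetSum,
    Finset.mul_sum (Finset.range k), Finset.mul_sum (Finset.range k)]
  symm
  refine Finset.sum_subset_zero_on_sdiff (Finset.range_mono hk) (fun r hr => ?_) fun r hr => ?_
  · simp only [Finset.mem_sdiff, Finset.mem_range] at hr
    rw [eval_mul, heval r hr.1, if_neg hr.2, mul_zero, zero_mul]
  · rw [Finset.mem_range] at hr
    rw [eval_mul, eval_mul, heval r (hr.trans_le hk), if_pos hr, eval_C, eval_pow, eval_X]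
    field_simp
    ring

end MattsonSolomon

section GeneratorBlocks

variable {F : Type*} [Field F] [DecidableEq F] {n k : ℕ} [NeZero n] {α : F}

/-- The coefficient `G_ν` of `z^ν` in the generator matrix `rsMatrix`. -/
noncomputable abbrev rsCoeffMatrix (hα : orderOf α = n) (k ν : ℕ) : Matrix (Fin k) (Fin n) F :=
  coeffMatrix (rsAut hα k) (rsIdem n α k) k ν

theorem vecMul_rsCoeffMatrix (hα : orderOf α = n) (hk : k ≤ n) (ν : ℕ) (w : Fin k → F)
    (l : Fin n) :
    (w ᵥ* rsCoeffMatrix hα k ν) l = (α ^ (l : ℕ)) ^ (k * ν + 1) *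
      (mattsonSolomon n α k (ofFn k w)).eval (α ^ (l : ℕ)) := by
  rw [vecMul_coeffMatrix, rsAut, coords_scaleAut_pow, coords_mk_mul_rsIdem hα hk, ← mul_assoc]
  ring

theorem add_one_le_hammingNorm_sum_vecMul_rsCoeffMatrix (hα : orderOf α = n) (hk : k ≤ n)
    (s e : ℕ) (w : ℕ → Fin k → F) (hw : ∃ ν ∈ Finset.Ico s e, w ν ≠ 0) :
    n + 1 ≤ hammingNorm (∑ ν ∈ Finset.Ico s e, w ν ᵥ* rsCoeffMatrix hα k ν) + k * (e - s) := by
  set p : ℕ → F[X] := fun j => mattsonSolomon n α k (ofFn k (w (s + j)))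
  set P := ∑ j ∈ Finset.range (e - s), p j * X ^ (k * j)
  have hp (j : ℕ) : (p j).degree < k := degree_mattsonSolomon_lt _
  have hP : P ≠ 0 := by
    obtain ⟨ν, hν, hwν⟩ := hw
    rw [Finset.mem_Ico] at hν
    refine sum_mul_X_pow_ne_zero hp ⟨ν - s, by omega, mattsonSolomon_ne_zero hα hk ?_ ?_⟩
    · rw [Nat.add_sub_cancel' hν.1]
      exact (map_ne_zero_iff _ (injective_ofFn k)).2 hwν
    · exact ofFn_degree_lt _
  have hword : ∑ ν ∈ Finset.Ico s e, w ν ᵥ* rsCoeffMatrix hα k ν =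
      fun l : Fin n => (α ^ (l : ℕ)) ^ (k * s + 1) * P.eval (α ^ (l : ℕ)) := by
    ext l
    rw [Finset.sum_Ico_eq_sum_range, Finset.sum_apply, eval_finsetSum, Finset.mul_sum]
    refine Finset.sum_congr rfl fun j _ => ?_
    rw [vecMul_rsCoeffMatrix hα hk, eval_mul, eval_pow, eval_X]
    ring
  have hα0 : α ≠ 0 := by
    rintro rfl
    exact NeZero.ne n (hα ▸ orderOf_zero F)
  have hweight := card_le_hammingNorm_eval_add_natDegree (x := fun l : Fin n => α ^ (l : ℕ))
    (fun i j h => Fin.ext (pow_injOn_range hα (by simp) (by simp) h))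
    (c := fun l => (α ^ (l : ℕ)) ^ (k * s + 1)) (fun l => pow_ne_zero _ (pow_ne_zero _ hα0)) hP
  have hdeg : P.natDegree < k * (e - s) :=
    (natDegree_lt_iff_degree_lt hP).2 (degree_sum_mul_X_pow_lt hp)
  rw [Fintype.card_fin, ← hword] at hweight
  omega

end GeneratorBlocks

section PolynomialVectors

variable {F ι : Type*} [Field F]

theorem exists_coeffVec_ne_zero {u : ι → F[X]} (hu : u ≠ 0) : ∃ i, coeffVec u i ≠ 0 := by
  contrapose! hu
  exact funext fun l => ext fun i => congrFun (hu i) l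

variable [Fintype ι]

theorem coeffVec_eq_zero_of_sup_natDegree_lt {u : ι → F[X]} {i : ℕ}
    (hi : Finset.univ.sup (fun l => (u l).natDegree) < i) : coeffVec u i = 0 :=
  funext fun l => coeff_eq_zero_of_natDegree_lt <|
    (Finset.le_sup (f := fun l => (u l).natDegree) (Finset.mem_univ l)).trans_lt hi

theorem coeffVec_eq_zero_of_vecDegree_lt {u : ι → F[X]} {i : ℕ} (hi : vecDegree u < i) :
    coeffVec u i = 0 :=
  funext fun l => coeff_eq_zero_of_degree_lt <|
    (Finset.le_sup (f := fun l => (u l).degree) (Finset.mem_univ l)).trans_lt hi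

theorem coeffVec_ne_zero_of_vecDegree_eq {u : ι → F[X]} {N : ℕ} (hN : vecDegree u = N) :
    coeffVec u N ≠ 0 := by
  obtain ⟨l, -, hl⟩ := (Finset.le_sup_iff (WithBot.bot_lt_coe N)).1 hN.ge
  have hle : (u l).degree ≤ N := hN ▸ Finset.le_sup (f := fun l => (u l).degree) (Finset.mem_univ l)
  exact fun h0 => coeff_ne_zero_of_eq_degree (hle.antisymm hl) (congrFun h0 l)

theorem polyWeight_eq_sum_range [DecidableEq F] (v : ι → F[X]) :
    polyWeight v = ∑ t ∈ Finset.range (Finset.univ.sup (fun l => (v l).natDegree) + 1),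
      hammingNorm (coeffVec v t) := by
  unfold polyWeight
  congr!

theorem sum_hammingNorm_le_polyWeight [DecidableEq F] (v : ι → F[X]) (S : Finset ℕ) :
    ∑ t ∈ S, hammingNorm (coeffVec v t) ≤ polyWeight v := by
  rw [polyWeight_eq_sum_range]
  refine Finset.sum_le_sum_of_ne_zero fun t _ ht => ?_
  by_contra hlt
  rw [Finset.mem_range, not_lt, Nat.succ_le_iff] at hlt
  exact ht (hammingNorm_eq_zero.2 (coeffVec_eq_zero_of_sup_natDegree_lt hlt))

theorem polyWeight_le_sum_hammingNorm [DecidableEq F] {v : ι → F[X]} {S : Finset ℕ}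
    (h : ∀ t ∉ S, coeffVec v t = 0) : polyWeight v ≤ ∑ t ∈ S, hammingNorm (coeffVec v t) := by
  rw [polyWeight_eq_sum_range]
  refine Finset.sum_le_sum_of_ne_zero fun t _ ht => ?_
  by_contra hS
  exact ht (hammingNorm_eq_zero.2 (h t hS))

theorem polyWeight_zero : polyWeight (0 : ι → F[X]) = 0 := by
  classical
  exact Nat.le_zero.1 (polyWeight_le_sum_hammingNorm (S := ∅) fun _ _ => rfl)

end PolynomialVectors

section AtomicSegments

/-- `[a, b]` supports the first atomic piece of the sequence `U`: a shift register with the `m + 1`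
cells `U t, …, U (t - m)` is zero before the time `a`, nonzero at the times `a, …, b + m`, and zero
again at the time `b + m + 1`. -/
structure IsAtomicSegment {M : Type*} [Zero M] (m : ℕ) (U : ℕ → M) (a b : ℕ) : Prop where
  le : a ≤ b
  eq_zero_of_lt : ∀ i < a, U i = 0
  eq_zero_of_gt : ∀ i, b < i → i ≤ b + m → U i = 0
  exists_ne_zero : ∀ t, a ≤ t → t ≤ b + m → ∃ i ≤ t, t ≤ i + m ∧ U i ≠ 0

theorem exists_isAtomicSegment {M : Type*} [Zero M] (m : ℕ) {U : ℕ → M} (hU : ∃ i, U i ≠ 0)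
    {D : ℕ} (hD : ∀ i, D < i → U i = 0) : ∃ a b, IsAtomicSegment m U a b := by
  classical
  obtain ⟨a, ha, hlo⟩ : ∃ a, U a ≠ 0 ∧ ∀ i < a, U i = 0 :=
    ⟨Nat.find hU, Nat.find_spec hU, fun i hi => not_not.1 (Nat.find_min hU hi)⟩
  have hend : ∃ e, a < e ∧ ∀ i ≤ e, e ≤ i + m → U i = 0 :=
    ⟨max a D + m + 1, by omega, fun i _ hi => hD i (by omega)⟩
  obtain ⟨hae, hzero⟩ := Nat.find_spec hend
  have hmin := fun e => Nat.find_min hend (m := e)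
  set e := Nat.find hend
  have hwindow (t : ℕ) (hat : a ≤ t) (hte : t < e) : ∃ i ≤ t, t ≤ i + m ∧ U i ≠ 0 := by
    rcases hat.eq_or_lt with rfl | hlt
    · exact ⟨a, le_rfl, by omega, ha⟩
    · have := hmin t hte
      push Not at this
      exact this hlt
  obtain ⟨b, hbe, heb, hb⟩ := hwindow (e - 1) (by omega) (by omega)
  have he : e = b + m + 1 := by
    have := mt (hzero b (by omega)) hb
    omega
  refine ⟨a, b, not_lt.1 fun hba => hb (hlo b hba), hlo, fun i hi hi' => ?_, fun t hat ht => ?_⟩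
  · exact hzero i (by omega) (by omega)
  · exact hwindow t hat (by omega)

theorem sum_Icc_card_window {a b : ℕ} (hab : a ≤ b) (m : ℕ) :
    ∑ t ∈ Finset.Icc a (b + m), (min (t - a) m + 1 - (t - b)) = (b - a + 1) * (m + 1) := by
  have habove (t : ℕ) (ht : t ∈ Finset.Icc a (b + m)) : min (t - a) m + 1 - (t - b) =
      (Finset.bipartiteAbove (fun t ν => a + ν ≤ t ∧ t ≤ b + ν) (Finset.range (m + 1)) t).card := by
    rw [Finset.mem_Icc] at ht
    rw [← Nat.card_Ico]
    congr 1
    ext ν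
    simp only [Finset.mem_Ico, Finset.mem_bipartiteAbove, Finset.mem_range]
    omega
  have hbelow (ν : ℕ) (hν : ν ∈ Finset.range (m + 1)) :
      (Finset.bipartiteBelow (fun t ν => a + ν ≤ t ∧ t ≤ b + ν) (Finset.Icc a (b + m)) ν).card =
        b - a + 1 := by
    rw [Finset.mem_range] at hν
    have hcard : (Finset.Icc (a + ν) (b + ν)).card = b - a + 1 := by
      rw [Nat.card_Icc]
      omega
    rw [← hcard]
    congr 1
    ext t
    simp only [Finset.mem_Icc, Finset.mem_bipartiteBelow]
    omega
  rw [Finset.sum_congr rfl habove, Finset.sum_card_bipartiteAbove_eq_sum_card_bipartiteBelow,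
    Finset.sum_congr rfl hbelow, Finset.sum_const, Finset.card_range, smul_eq_mul, mul_comm]

theorem IsAtomicMessage.vecDegree_eq {F : Type*} [Field F] {k m N : ℕ} {u : Fin k → F[X]}
    (hu : IsAtomicMessage m (N + m + 1) u) : vecDegree u = N := by
  have hdeg : vecDegree u + ((m + 1 : ℕ) : WithBot ℕ) = N + ((m + 1 : ℕ) : WithBot ℕ) := by
    exact_mod_cast (add_assoc _ _ _).symm.trans hu.2.1
  exact (WithBot.add_right_inj WithBot.coe_ne_bot).1 hdeg

theorem IsAtomicMessage.isAtomicSegment {F : Type*} [Field F] {k m N : ℕ} {u : Fin k → F[X]}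
    (hu : IsAtomicMessage m (N + m + 1) u) : IsAtomicSegment m (coeffVec u) 0 N := by
  have hN := hu.vecDegree_eq
  obtain ⟨h0, -, hgap⟩ := hu
  refine ⟨N.zero_le, fun i hi => absurd hi i.not_lt_zero, fun i hi _ => ?_, fun t _ ht => ?_⟩
  · exact coeffVec_eq_zero_of_vecDegree_lt (hN ▸ WithBot.coe_lt_coe.2 hi)
  · rcases le_or_gt t m with htm | hmt
    · exact ⟨0, t.zero_le, by omega, h0⟩
    rcases le_or_gt N t with hNt | htN
    · exact ⟨N, hNt, ht, coeffVec_ne_zero_of_vecDegree_eq hN⟩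
    · obtain ⟨l, hl, hne⟩ := hgap (t - m) (by
        rw [hN]
        have : t - m + m ≤ N + 1 := by omega
        exact_mod_cast this)
      exact ⟨t - m + l, by omega, by omega, hne⟩

theorem exists_isAtomicMessage (F : Type*) [Field F] {k m : ℕ} (hk : 1 ≤ k) (hm : 1 ≤ m) (N : ℕ) :
    ∃ u : Fin k → F[X], IsAtomicMessage m (N + m + 1) u := by
  set p : F[X] := ∑ i ∈ Finset.range (N + 1), X ^ i
  have hcoeff (i : ℕ) : p.coeff i = if i < N + 1 then 1 else 0 := by
    simp only [p, finsetSum_coeff, coeff_X_pow, Finset.sum_ite_eq, Finset.mem_range]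
  have hdeg : p.degree = N := by
    refine degree_eq_of_le_of_coeff_ne_zero ?_ (by simp [hcoeff])
    refine (degree_le_iff_coeff_zero _ _).2 fun i hi => ?_
    have hNi : N < i := by exact_mod_cast hi
    rw [hcoeff, if_neg (by omega)]
  have hvec : vecDegree (fun _ : Fin k => p) = N := by
    rw [vecDegree, Finset.sup_const ⟨⟨0, hk⟩, Finset.mem_univ _⟩, hdeg]
  have hne (i : ℕ) (hi : i ≤ N) : coeffVec (fun _ : Fin k => p) i ≠ 0 := fun h0 => by
    simpa [coeffVec, hcoeff, hi] using congrFun h0 ⟨0, hk⟩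
  refine ⟨fun _ => p, hne 0 N.zero_le, ?_, fun i hi => ⟨0, hm, hne _ ?_⟩⟩
  · rw [hvec]
    norm_cast
  · rw [hvec] at hi
    have : i + m ≤ N + 1 := by exact_mod_cast hi
    omega

end AtomicSegments

section Codewords

variable {F : Type*} [Field F] {n k m : ℕ} [NeZero n]

theorem coeffVec_vecMul_genMatrix (σ : CycAlg F n ≃ₐ[F] CycAlg F n) (c : CycAlg F n)
    (u : Fin k → F[X]) (t : ℕ) :
    coeffVec (u ᵥ* genMatrix σ c k m) t =
      ∑ ν ∈ Finset.range (m + 1),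
        if ν ≤ t then coeffVec u (t - ν) ᵥ* coeffMatrix σ c k ν else 0 := by
  ext l
  simp only [coeffVec, genMatrix, Matrix.vecMul_sum, Matrix.vecMul_smul, Finset.sum_apply,
    finsetSum_coeff]
  refine Finset.sum_congr rfl fun ν _ => ?_
  rw [Pi.smul_apply, smul_eq_mul, X_pow_mul, coeff_mul_X_pow']
  split_ifs
  · simp only [Matrix.vecMul, dotProduct, finsetSum_coeff, Matrix.map_apply, coeff_mul_C, coeffVec]
  · rfl

theorem coeffVec_C (w : Fin k → F) (t : ℕ) :
    coeffVec (fun i => C (w i)) t = if t = 0 then w else 0 := by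
  ext i
  rw [coeffVec, coeff_C]
  split_ifs <;> rfl

theorem coeffVec_vecMul_genMatrix_C (σ : CycAlg F n ≃ₐ[F] CycAlg F n) (c : CycAlg F n)
    (w : Fin k → F) (t : ℕ) :
    coeffVec ((fun i => C (w i)) ᵥ* genMatrix σ c k m) t =
      if t ∈ Finset.range (m + 1) then w ᵥ* coeffMatrix σ c k t else 0 := by
  rw [coeffVec_vecMul_genMatrix,
    ← Finset.sum_ite_eq (Finset.range (m + 1)) t fun ν => w ᵥ* coeffMatrix σ c k ν]
  refine Finset.sum_congr rfl fun ν _ => ?_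
  rw [coeffVec_C]
  split_ifs with hνt hsub heq heq heq
  all_goals first | rfl | omega | rw [Matrix.zero_vecMul]

theorem coeffVec_vecMul_genMatrix_of_isAtomicSegment (σ : CycAlg F n ≃ₐ[F] CycAlg F n)
    (c : CycAlg F n) {u : Fin k → F[X]} {a b : ℕ} (hu : IsAtomicSegment m (coeffVec u) a b)
    {t : ℕ} (ht : t ∈ Finset.Icc a (b + m)) :
    coeffVec (u ᵥ* genMatrix σ c k m) t =
      ∑ ν ∈ Finset.Ico (t - b) (min (t - a) m + 1),
        coeffVec u (t - ν) ᵥ* coeffMatrix σ c k ν := by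
  rw [Finset.mem_Icc] at ht
  rw [coeffVec_vecMul_genMatrix]
  symm
  refine Finset.sum_subset_zero_on_sdiff (fun ν hν => ?_) (fun ν hν => ?_) fun ν hν => ?_
  · rw [Finset.mem_Ico] at hν
    exact Finset.mem_range.2 (by omega)
  · rw [Finset.mem_sdiff, Finset.mem_range, Finset.mem_Ico] at hν
    have hzero (hνt : ν ≤ t) : coeffVec u (t - ν) = 0 := by
      rcases lt_or_ge (t - ν) a with hlt | hge
      · exact hu.eq_zero_of_lt _ hlt
      · exact hu.eq_zero_of_gt _ (by omega) (by omega)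
    exact ite_eq_right_iff.2 fun hνt => by rw [hzero hνt, Matrix.zero_vecMul]
  · rw [Finset.mem_Ico] at hν
    rw [if_pos (by omega)]

end Codewords

section Distance

variable {F : Type*} [Field F] {n k m : ℕ} [NeZero n] {α : F}

theorem add_one_le_hammingNorm_coeffVec_vecMul_rsMatrix [DecidableEq F] (hα : orderOf α = n)
    (hk : k ≤ n) {u : Fin k → F[X]} {a b : ℕ} (hu : IsAtomicSegment m (coeffVec u) a b) {t : ℕ}
    (ht : t ∈ Finset.Icc a (b + m)) :
    n + 1 ≤ hammingNorm (coeffVec (u ᵥ* rsMatrix hα k m) t) +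
      k * (min (t - a) m + 1 - (t - b)) := by
  rw [rsMatrix, coeffVec_vecMul_genMatrix_of_isAtomicSegment _ _ hu ht]
  rw [Finset.mem_Icc] at ht
  obtain ⟨i, hit, hti, hi⟩ := hu.exists_ne_zero t ht.1 ht.2
  have hai : a ≤ i := not_lt.1 fun h => hi (hu.eq_zero_of_lt i h)
  have hib : i ≤ b := not_lt.1 fun h => hi (hu.eq_zero_of_gt i h (by omega))
  refine add_one_le_hammingNorm_sum_vecMul_rsCoeffMatrix hα hk _ _ (fun ν => coeffVec u (t - ν))
    ⟨t - i, Finset.mem_Ico.2 (by omega), ?_⟩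
  rwa [Nat.sub_sub_self hit]

theorem mul_le_polyWeight_vecMul_rsMatrix (hα : orderOf α = n) (hk : k ≤ n) {u : Fin k → F[X]}
    {a b : ℕ} (hu : IsAtomicSegment m (coeffVec u) a b) :
    (b - a + 1 + m) * (n + 1) ≤
      polyWeight (u ᵥ* rsMatrix hα k m) + k * ((b - a + 1) * (m + 1)) := by
  classical
  have hab := hu.le
  calc (b - a + 1 + m) * (n + 1)
      = ∑ t ∈ Finset.Icc a (b + m), (n + 1) := by
        rw [Finset.sum_const, Nat.card_Icc, smul_eq_mul]
        congr 1
        omega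
    _ ≤ ∑ t ∈ Finset.Icc a (b + m), (hammingNorm (coeffVec (u ᵥ* rsMatrix hα k m) t) +
          k * (min (t - a) m + 1 - (t - b))) :=
        Finset.sum_le_sum fun t ht => add_one_le_hammingNorm_coeffVec_vecMul_rsMatrix hα hk hu ht
    _ ≤ _ := by
        rw [Finset.sum_add_distrib, ← Finset.mul_sum, sum_Icc_card_window hab]
        exact Nat.add_le_add_right (sum_hammingNorm_le_polyWeight _ _) _

theorem mul_le_polyWeight_vecMul_rsMatrix_of_ne_zero (hα : orderOf α = n) (hk : k ≤ n)
    (hkm : k * (m + 1) ≤ n + 1) {u : Fin k → F[X]} (hu : u ≠ 0) :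
    (m + 1) * (n + 1) ≤ polyWeight (u ᵥ* rsMatrix hα k m) + k * (m + 1) := by
  obtain ⟨a, b, hab⟩ := exists_isAtomicSegment m (exists_coeffVec_ne_zero hu)
    fun _ => coeffVec_eq_zero_of_sup_natDegree_lt
  have hweight := mul_le_polyWeight_vecMul_rsMatrix hα hk hab
  have hlong := Nat.mul_le_mul_left (b - a) hkm
  linarith

theorem hammingNorm_vecMul_rsCoeffMatrix_le [DecidableEq F] (hα : orderOf α = n) (ν : ℕ)
    (w : Fin k → F) :
    hammingNorm (w ᵥ* rsCoeffMatrix hα k ν) ≤ hammingNorm (w ᵥ* rsCoeffMatrix hα k 0) := by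
  have hscale : w ᵥ* rsCoeffMatrix hα k ν =
      fun l : Fin n => ((α ^ k) ^ (l : ℕ)) ^ ν * (w ᵥ* rsCoeffMatrix hα k 0) l := by
    ext l
    rw [vecMul_coeffMatrix, vecMul_coeffMatrix, rsAut, coords_scaleAut_pow, pow_zero,
      AlgEquiv.one_apply]
  rw [hscale]
  exact hammingNorm_comp_le_hammingNorm (fun (l : Fin n) x => ((α ^ k) ^ (l : ℕ)) ^ ν * x)
    fun _ => mul_zero _

theorem exists_polyWeight_vecMul_rsMatrix_add_le (hα : orderOf α = n) (hk1 : 1 ≤ k) (hkn : k ≤ n)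
    (m : ℕ) : ∃ u : Fin k → F[X], u ≠ 0 ∧
      polyWeight (u ᵥ* rsMatrix hα k m) + k * (m + 1) ≤ (m + 1) * (n + 1) := by
  classical
  have : NeZero k := ⟨by omega⟩
  obtain ⟨w, hw0, hw⟩ := exists_ne_zero_hammingNorm_add_finrank_le
    (rsCoeffMatrix hα k 0).vecMulLinear (by simpa using hkn)
  rw [Module.finrank_fin_fun, Fintype.card_fin, Matrix.vecMulLinear_apply] at hw
  have hword (t : ℕ) := coeffVec_vecMul_genMatrix_C (m := m) (rsAut hα k) (rsIdem n α k) w t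
  refine ⟨fun i => C (w i), fun h0 => hw0 (funext fun i => C_eq_zero.1 (congrFun h0 i)), ?_⟩
  have hweight : polyWeight ((fun i => C (w i)) ᵥ* rsMatrix hα k m) ≤
      (m + 1) * hammingNorm (w ᵥ* rsCoeffMatrix hα k 0) := by
    refine (polyWeight_le_sum_hammingNorm (S := Finset.range (m + 1)) fun t ht => ?_).trans
      ((Finset.sum_le_card_nsmul _ _ _ fun t ht => ?_).trans_eq
        (by rw [Finset.card_range, smul_eq_mul]))
    · rw [rsMatrix, hword, if_neg ht]
    · rw [rsMatrix, hword, if_pos ht]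
      exact hammingNorm_vecMul_rsCoeffMatrix_le hα t w
  nlinarith

theorem freeDist_code_rsMatrix (hα : orderOf α = n) (hk1 : 1 ≤ k) (hkn : k ≤ n)
    (hkm : k * (m + 1) ≤ n + 1) :
    freeDist (code (rsMatrix hα k m)) + k * (m + 1) = (m + 1) * (n + 1) := by
  have hlower {u : Fin k → F[X]} (hu : u ≠ 0) :=
    mul_le_polyWeight_vecMul_rsMatrix_of_ne_zero (m := m) hα hkn hkm hu
  obtain ⟨u, hu0, hu⟩ := exists_polyWeight_vecMul_rsMatrix_add_le hα hk1 hkn m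
  have huG : u ᵥ* rsMatrix hα k m ≠ 0 := fun h0 => by
    have := hlower hu0
    rw [h0, polyWeight_zero] at this
    nlinarith
  have hleast : IsLeast {w | ∃ v ∈ code (rsMatrix hα k m), v ≠ 0 ∧ polyWeight v = w}
      (polyWeight (u ᵥ* rsMatrix hα k m)) := by
    refine ⟨⟨_, ⟨u, rfl⟩, huG, rfl⟩, ?_⟩
    rintro _ ⟨_, ⟨u', rfl⟩, hv, rfl⟩
    have hu' : u' ≠ 0 := by
      rintro rfl
      exact hv (map_zero _)
    exact Nat.le_of_add_le_add_right (hu.trans (hlower hu'))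
  rw [freeDist, hleast.csInf_eq]
  exact hu.antisymm (hlower hu0)

theorem mul_le_extRowDist_rsMatrix (hα : orderOf α = n) (hk1 : 1 ≤ k) (hkn : k ≤ n) (hm : 1 ≤ m)
    (N : ℕ) : (N + 1 + m) * (n + 1) ≤
      extRowDist (rsMatrix hα k m) m (N + m + 1) + k * ((N + 1) * (m + 1)) := by
  obtain ⟨u₀, hu₀⟩ := exists_isAtomicMessage F hk1 hm N
  obtain ⟨u, hu, hweight⟩ := Nat.sInf_mem (s := {w | ∃ u : Fin k → F[X],
    IsAtomicMessage m (N + m + 1) u ∧ polyWeight (u ᵥ* rsMatrix hα k m) = w}) ⟨_, u₀, hu₀, rfl⟩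
  rw [extRowDist, ← hweight]
  exact mul_le_polyWeight_vecMul_rsMatrix hα hkn hu.isAtomicSegment

end Distance

end RSConv

theorem theorem4p3_general {F : Type*} [Field F] {n : ℕ} [NeZero n] {k : ℕ} (hk : 1 ≤ k)
    {α : F} (hα : orderOf α = n) {m : ℕ} (hm : 1 ≤ m) (hkm : k * (m + 1) ≤ n + 1) :
    (RSConv.freeDist (RSConv.code (RSConv.rsMatrix hα k m)) : ℤ) =
        ((m : ℤ) + 1) * ((n : ℤ) - k + 1) ∧
      ∀ j : ℕ, m + 1 ≤ j →
        ((m : ℤ) + 1) * ((n : ℤ) - k + 1) +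
            ((j : ℤ) - 1 - m) * ((n : ℤ) - (k : ℤ) * ((m : ℤ) + 1) + 1) ≤
          (RSConv.extRowDist (RSConv.rsMatrix hα k m) m j : ℤ) := by
  have hkn : k ≤ n := by nlinarith
  refine ⟨?_, fun j hj => ?_⟩
  · have hdist := RSConv.freeDist_code_rsMatrix hα hk hkn hkm
    zify at hdist
    linarith
  · obtain ⟨N, rfl⟩ : ∃ N, j = N + m + 1 := ⟨j - (m + 1), by omega⟩
    have hrow := RSConv.mul_le_extRowDist_rsMatrix hα hk hkn hm N
    zify at hrow
    push_cast
    linarith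

theorem theorem4p3 {F : Type*} [Field F] [Fintype F] {n : ℕ} [NeZero n]
    (hn : n = Fintype.card F - 1) {k : ℕ} (hk1 : 1 ≤ k) (hk2 : 2 * k ≤ n)
    {α : F} (hα : orderOf α = n) {m : ℕ} (hm1 : 1 ≤ m) (hm2 : m ≤ n / k - 1) :
    (RSConv.freeDist (RSConv.code (RSConv.rsMatrix hα k m)) : ℤ) =
        ((m : ℤ) + 1) * ((n : ℤ) - k + 1) ∧
      ∀ j : ℕ, m + 1 ≤ j →
        ((m : ℤ) + 1) * ((n : ℤ) - k + 1) +
            ((j : ℤ) - 1 - m) * ((n : ℤ) - (k : ℤ) * ((m : ℤ) + 1) + 1) ≤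
          (RSConv.extRowDist (RSConv.rsMatrix hα k m) m j : ℤ) :=
  theorem4p3_general hk1 hα hm1 <|
    (Nat.mul_le_mul_left k (by omega : m + 1 ≤ n / k)).trans ((Nat.mul_div_le n k).trans n.le_succ)
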